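/- Let $\mathbb F$ be $\mathbb R$ or $\mathbb C$. For a Banach space $E$ over $\mathbb F$ with dual $E'$, a bounded set $B\subseteq E$ is called limited if $\lim_{n}\sup_{x\in B}|\chi_n(x)|=0$ for every weak$^*$ null sequence $(\chi_n)$ in $E'$; $E$ is called Gelfand–Phillips if every limited subset of $E$ has compact closure. A Tychonoff space $X$ is called an $F$-space if for every continuous $g:X\to\mathbb R$ and $A=\{x\in X: g(x)\neq 0\}$, every bounded continuous function $A\to\mathbb R$ has a continuous extension $X\to\mathbb R$. For compact Hausdorff $K$, let $C(K)$ be the Banach space of continuous functions $K\to\mathbb F$ with the supremum norm. (1) For every infinite compact Hausdorff $F$-space $K$, the Banach space $C(K)$ is not Gelfand–Phillips. (2) For every discrete space $\Gamma$, the Stone–Čech compactification $\beta\Gamma$ is a compact $F$-space. Consequently, if $\Gamma$ is infinite, $C(\beta\Gamma)$ is not Gelfand–Phillips; in particular (Phillips), the Banach space $\ell_\infty=\ell_\infty(\mathbb N,\mathbb F)$ is not Gelfand–Phillips. -/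

import Mathlib

open Filter Topology Bornology
open scoped BoundedContinuousFunction

section GelfandPhillips

variable (𝕜 : Type*) [RCLike 𝕜] {E : Type*} [NormedAddCommGroup E] [NormedSpace 𝕜 E]

/-- The quantity `‖χ‖_B = sup {|χ(x)| : x ∈ B}` for a functional `χ` in the dual of `E` and a
bounded subset `B` of `E` (it is `0` for empty `B`). -/
noncomputable def supNormOn (B : Set E) (χ : WeakDual 𝕜 E) : ℝ :=
  ⨆ x : B, ‖χ (x : E)‖

/-- A subset `B` of a Banach space is limited if it is bounded and every weak-star null sequence
of functionals converges to zero uniformly on `B`. -/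
def IsLimitedSet (B : Set E) : Prop :=
  IsBounded B ∧ ∀ χ : ℕ → WeakDual 𝕜 E, Tendsto χ atTop (𝓝 0) →
    Tendsto (fun n => supNormOn 𝕜 B (χ n)) atTop (𝓝 0)

/-- A Banach space is Gelfand--Phillips if each limited subset has compact closure. -/
def IsGelfandPhillips (𝕜 : Type*) [RCLike 𝕜] (E : Type*) [NormedAddCommGroup E]
    [NormedSpace 𝕜 E] : Prop :=
  ∀ B : Set E, IsLimitedSet 𝕜 B → IsCompact (closure B)

end GelfandPhillips

section FSpace

variable {X : Type*} [TopologicalSpace X]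

/-- A functionally open (cozero) set: the set of points where some continuous real-valued
function does not vanish. -/
def IsFunctionallyOpen (A : Set X) : Prop :=
  ∃ g : C(X, ℝ), A = {x | g x ≠ 0}

/-- `A` is `C^*`-embedded in `X`: each bounded continuous real-valued function on `A` has a
continuous extension to `X`. -/
def IsCStarEmbedded (A : Set X) : Prop :=
  ∀ f : A →ᵇ ℝ, ∃ F : C(X, ℝ), ∀ x : A, F x = f x

/-- A (Tychonoff) space is an `F`-space if every functionally open subset is `C^*`-embedded. -/
def IsFSpace (X : Type*) [TopologicalSpace X] [T35Space X] : Prop :=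
  ∀ A : Set X, IsFunctionallyOpen A → IsCStarEmbedded A

end FSpace

/-!
If `K` is infinite, then `C(K)` contains norm-one functions `f n` with disjoint supports. Such a
sequence has no convergent subsequence, so it suffices to see that it is limited when `K` is an
`F`-space; for this, `χ n (f n) → 0` has to be shown for every weak-star null sequence `χ n`.
Otherwise `2δ ≤ |χ n (f n)|` along a subsequence. Split the indices into infinitely many infinite
classes `A i`. The `F`-space property glues the `f n`, `n ∈ A i`, to a single function `H i`.
Since `χ n (H i) → 0`, some `k i ∈ A i` satisfies `δ ≤ |χ (k i) (H i - f (k i))|`. The functions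
`H i - f (k i)` vanish on the support of every `f (k j)`, so discarding their supports preserves
the sequence `f (k i)` while using up at least `δ` of the variation of `χ (k i)`. The variations
of the `χ n` being uniformly bounded, this can be repeated only finitely often.

The space `ℓ_∞(Γ)` contains `C(βΓ)` isometrically, and the Gelfand–Phillips property passes to
complete subspaces.
-/

open Function (support)
open scoped Function

section LimitedSets

variable {𝕜 : Type*} [RCLike 𝕜] {E F : Type*} [NormedAddCommGroup E] [NormedSpace 𝕜 E]
  [NormedAddCommGroup F] [NormedSpace 𝕜 F]

lemma tendsto_weakDual_apply {ι : Type*} {l : Filter ι} {χ : ι → WeakDual 𝕜 E}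
    {ψ : WeakDual 𝕜 E} (hχ : Tendsto χ l (𝓝 ψ)) (x : E) :
    Tendsto (fun i => χ i x) l (𝓝 (ψ x)) :=
  ((WeakDual.eval_continuous x).tendsto ψ).comp hχ

lemma tendsto_norm_weakDual_apply_zero {ι : Type*} {l : Filter ι} {χ : ι → WeakDual 𝕜 E}
    (hχ : Tendsto χ l (𝓝 0)) (x : E) : Tendsto (fun i => ‖χ i x‖) l (𝓝 0) :=
  tendsto_zero_iff_norm_tendsto_zero.1 (tendsto_weakDual_apply hχ x)

lemma exists_norm_le_of_tendsto_weakDual [CompleteSpace E] {χ : ℕ → WeakDual 𝕜 E}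
    {ψ : WeakDual 𝕜 E} (hχ : Tendsto χ atTop (𝓝 ψ)) :
    ∃ C, ∀ n, ‖WeakDual.toStrongDual (χ n)‖ ≤ C := by
  refine banach_steinhaus fun x => ?_
  obtain ⟨C, hC⟩ := (tendsto_weakDual_apply hχ x).norm.bddAbove_range
  exact ⟨C, fun n => hC ⟨n, rfl⟩⟩

lemma supNormOn_nonneg (B : Set E) (χ : WeakDual 𝕜 E) : 0 ≤ supNormOn 𝕜 B χ :=
  Real.iSup_nonneg fun _ => norm_nonneg _

lemma supNormOn_image (T : E →L[𝕜] F) (B : Set E) (χ : WeakDual 𝕜 F) :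
    supNormOn 𝕜 (T '' B) χ =
      supNormOn 𝕜 B (StrongDual.toWeakDual ((WeakDual.toStrongDual χ).comp T)) :=
  ((Set.imageFactorization_surjective (f := T) (s := B)).iSup_comp fun y => ‖χ y‖).symm

lemma supNormOn_range_le {ι : Type*} {f : ι → E} {χ : WeakDual 𝕜 E} {ε : ℝ} (hε : 0 ≤ ε)
    (h : ∀ i, ‖χ (f i)‖ ≤ ε) : supNormOn 𝕜 (Set.range f) χ ≤ ε :=
  Real.iSup_le (Set.forall_subtype_range_iff.2 h) hε

lemma IsLimitedSet.image {B : Set E} (hB : IsLimitedSet 𝕜 B) (T : E →L[𝕜] F) :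
    IsLimitedSet 𝕜 (T '' B) := by
  refine ⟨T.lipschitz.isBounded_image hB.1, fun χ hχ => ?_⟩
  simp only [supNormOn_image]
  refine hB.2 _ (tendsto_iff_forall_eval_tendsto_topDualPairing.2 fun x => ?_)
  exact tendsto_weakDual_apply hχ (T x)

lemma isLimitedSet_range_of_tendsto {f : ℕ → E} (hf : IsBounded (Set.range f))
    (h : ∀ χ : ℕ → WeakDual 𝕜 E, Tendsto χ atTop (𝓝 0) → ∀ φ : ℕ → ℕ, StrictMono φ →
      Tendsto (fun n => χ n (f (φ n))) atTop (𝓝 0)) :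
    IsLimitedSet 𝕜 (Set.range f) := by
  refine ⟨hf, fun χ hχ => ?_⟩
  have hdiag : Tendsto (fun p : ℕ × ℕ => χ p.1 (f p.2)) (atTop ×ˢ atTop) (𝓝 0) := by
    refine tendsto_of_seq_tendsto fun u hu => tendsto_of_subseq_tendsto fun ns hns => ?_
    have hu' := hu.comp hns
    obtain ⟨φ, hφ, hφu⟩ := strictMono_subseq_of_tendsto_atTop (tendsto_snd.comp hu')
    exact ⟨φ, h _ (hχ.comp ((tendsto_fst.comp hu').comp hφ.tendsto_atTop)) _ hφu⟩
  rw [Metric.tendsto_nhds] at hdiag ⊢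
  intro ε hε
  obtain ⟨p, hp, q, hq, hpq⟩ := eventually_prod_iff.1 (hdiag (ε / 2) (half_pos hε))
  obtain ⟨N, hN⟩ := eventually_atTop.1 hq
  have hinit : ∀ᶠ n in atTop, ∀ i ∈ Set.Iio N, ‖χ n (f i)‖ < ε / 2 := by
    refine (eventually_all_finite (Set.finite_Iio N)).2 fun i _ => ?_
    exact (tendsto_norm_weakDual_apply_zero hχ (f i)).eventually_lt_const (half_pos hε)
  filter_upwards [hp, hinit] with n hpn hn
  have hle : supNormOn 𝕜 (Set.range f) (χ n) ≤ ε / 2 := by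
    refine supNormOn_range_le (half_pos hε).le fun i => ?_
    rcases lt_or_ge i N with hi | hi
    · exact (hn i hi).le
    · simpa only [dist_zero_right] using (hpq hpn (hN i hi)).le
  rw [dist_zero_right, Real.norm_of_nonneg (supNormOn_nonneg _ _)]
  exact hle.trans_lt (half_lt_self hε)

lemma IsGelfandPhillips.of_linearIsometry [CompleteSpace E] (T : E →ₗᵢ[𝕜] F)
    (hF : IsGelfandPhillips 𝕜 F) : IsGelfandPhillips 𝕜 E := fun B hB => by
  have hcompact := T.isometry.isClosedEmbedding.isCompact_preimage
    (hF _ (hB.image T.toContinuousLinearMap))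
  refine hcompact.of_isClosed_subset isClosed_closure (closure_minimal (fun x hx => ?_)
    (isClosed_closure.preimage T.continuous))
  exact subset_closure ⟨x, hx, rfl⟩

end LimitedSets

section CozeroSets

variable {X : Type*} [TopologicalSpace X]

lemma isFunctionallyOpen_empty : IsFunctionallyOpen (∅ : Set X) :=
  ⟨0, by simp⟩

lemma isFunctionallyOpen_support {E : Type*} [NormedAddCommGroup E] (g : C(X, E)) :
    IsFunctionallyOpen (support g) :=
  ⟨⟨fun x => ‖g x‖, by fun_prop⟩, by ext x; simp⟩

lemma IsFunctionallyOpen.isOpen {A : Set X} (hA : IsFunctionallyOpen A) : IsOpen A := by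
  obtain ⟨g, rfl⟩ := hA
  exact isOpen_ne_fun g.continuous continuous_const

lemma IsFunctionallyOpen.iUnion {ι : Type*} [Countable ι] {U : ι → Set X}
    (hU : ∀ i, IsFunctionallyOpen (U i)) : IsFunctionallyOpen (⋃ i, U i) := by
  choose g hg using hU
  have := Encodable.ofCountable ι
  obtain ⟨ε, hε, _, hsum, -⟩ := posSumOfEncodable one_pos ι
  have hnonneg : ∀ i x, 0 ≤ ε i * min |g i x| 1 := fun i x =>
    mul_nonneg (hε i).le (by positivity)
  have hle : ∀ i x, ε i * min |g i x| 1 ≤ ε i := fun i x =>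
    mul_le_of_le_one_right (hε i).le (min_le_right _ _)
  have hsummable : ∀ x, Summable fun i => ε i * min |g i x| 1 := fun x =>
    .of_nonneg_of_le (hnonneg · x) (hle · x) hsum.summable
  refine ⟨⟨fun x => ∑' i, ε i * min |g i x| 1, ?_⟩, ?_⟩
  · refine continuous_tsum (fun i => by fun_prop) hsum.summable fun i x => ?_
    rw [Real.norm_of_nonneg (hnonneg i x)]
    exact hle i x
  · ext x
    have hzero : ∑' i, ε i * min |g i x| 1 = 0 ↔ ∀ i, g i x = 0 := by
      rw [← (hsummable x).hasSum_iff, hasSum_zero_iff_of_nonneg (hnonneg · x), funext_iff]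
      refine forall_congr' fun i => ?_
      rw [Pi.zero_apply, mul_eq_zero_iff_left (hε i).ne']
      grind
    simp [hg, hzero]


lemma IsFunctionallyOpen.union {A B : Set X} (hA : IsFunctionallyOpen A)
    (hB : IsFunctionallyOpen B) : IsFunctionallyOpen (A ∪ B) := by
  rw [Set.union_eq_iUnion]
  exact .iUnion (Bool.forall_bool.2 ⟨hB, hA⟩)

end CozeroSets

section Gluing

variable {𝕜 : Type*} [RCLike 𝕜] {X : Type*} [TopologicalSpace X]

lemma exists_continuous_norm_le_eqOn {E : Type*} [NormedAddCommGroup E] [NormedSpace ℝ E]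
    {A : Set X} {r : ℝ} (hr : 0 ≤ r) (F : C(X, E)) (hF : ∀ x ∈ A, ‖F x‖ ≤ r) :
    ∃ G : C(X, E), (∀ x, ‖G x‖ ≤ r) ∧ Set.EqOn G F A := by
  rcases hr.eq_or_lt with rfl | hr
  · exact ⟨0, by simp, fun x hx => (norm_le_zero_iff.1 (hF x hx)).symm⟩
  -- Compose with the radial retraction of `E` onto the ball of radius `r`.
  have hmax : ∀ x, 0 < max r ‖F x‖ := fun x => hr.trans_le (le_max_left _ _)
  refine ⟨⟨fun x => (r / max r ‖F x‖) • F x, ?_⟩, fun x => ?_, fun x hx => ?_⟩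
  · exact (continuous_const.div (by fun_prop) fun x => (hmax x).ne').smul F.continuous
  · rw [ContinuousMap.coe_mk, norm_smul, Real.norm_of_nonneg (div_pos hr (hmax x)).le,
      div_mul_eq_mul_div, div_le_iff₀ (hmax x)]
    gcongr
    exact le_max_right _ _
  · rw [ContinuousMap.coe_mk, max_eq_left (hF x hx), div_self hr.ne', one_smul]

lemma IsCStarEmbedded.exists_extension {A : Set X} (hA : IsCStarEmbedded A) (f : A →ᵇ 𝕜) :
    ∃ F : C(X, 𝕜), (∀ x, ‖F x‖ ≤ ‖f‖) ∧ ∀ x : A, F x = f x := by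
  obtain ⟨R, hR⟩ := hA (f.comp _ (RCLike.reCLM (K := 𝕜)).lipschitz)
  obtain ⟨I, hI⟩ := hA (f.comp _ (RCLike.imCLM (K := 𝕜)).lipschitz)
  let F : C(X, 𝕜) := ⟨fun x => (R x : 𝕜) + (I x : 𝕜) * RCLike.I, by fun_prop⟩
  have hF : ∀ x : A, F x = f x := fun x => by
    simp only [F, ContinuousMap.coe_mk, hR, hI]
    exact RCLike.re_add_im (f x)
  obtain ⟨G, hG, hGF⟩ := exists_continuous_norm_le_eqOn (norm_nonneg f) F (A := A)
    fun x hx => (congrArg norm (hF ⟨x, hx⟩)).trans_le (f.norm_coe_le_norm _)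
  exact ⟨G, hG, fun x => (hGF x.2).trans (hF x)⟩

lemma IsFSpace.exists_eqOn_of_pairwise_disjoint [T35Space X] (hX : IsFSpace X) {ι : Type*}
    [Countable ι] {U : ι → Set X} (hU : ∀ i, IsFunctionallyOpen (U i))
    (hdisj : Pairwise (Disjoint on U)) {r : ℝ} (hr : 0 ≤ r) (g : ι → C(X, 𝕜))
    (hg : ∀ i, ∀ x ∈ U i, ‖g i x‖ ≤ r) :
    ∃ h : C(X, 𝕜), (∀ x, ‖h x‖ ≤ r) ∧ ∀ i, Set.EqOn h (g i) (U i) := by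
  let S : ι → Set (⋃ i, U i) := fun i => Subtype.val ⁻¹' U i
  have hS : ∀ x, ∃ i, S i ∈ 𝓝 x := fun x =>
    (Set.mem_iUnion.1 x.2).imp fun i hi =>
      ((hU i).isOpen.preimage continuous_subtype_val).mem_nhds hi
  have hagree : ∀ i j x (hi : x ∈ S i) (hj : x ∈ S j),
      ((g i).restrict _).restrict (S i) ⟨x, hi⟩ = ((g j).restrict _).restrict (S j) ⟨x, hj⟩ := by
    intro i j x hi hj
    obtain rfl : i = j := hdisj.eq (Set.not_disjoint_iff.2 ⟨x, hi, hj⟩)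
    rfl
  let glued : C(⋃ i, U i, 𝕜) := .liftCover S (fun i => ((g i).restrict _).restrict (S i)) hagree hS
  have hglued : ∀ i x (hx : x ∈ U i), glued ⟨x, Set.mem_iUnion_of_mem i hx⟩ = g i x :=
    fun i x hx => ContinuousMap.liftCover_coe (S := S) (i := i) ⟨⟨x, _⟩, hx⟩
  have hbound : ∀ x, ‖glued x‖ ≤ r := by
    rintro ⟨x, hx⟩
    obtain ⟨i, hi⟩ := Set.mem_iUnion.1 hx
    exact (congrArg norm (hglued i x hi)).trans_le (hg i x hi)
  obtain ⟨h, hnorm, hext⟩ := (hX _ (.iUnion hU)).exists_extension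
    (.ofNormedAddCommGroup glued glued.continuous r hbound)
  exact ⟨h, fun x =>
    (hnorm x).trans (BoundedContinuousFunction.norm_ofNormedAddCommGroup_le _ hr _),
    fun i x hx => (hext ⟨x, Set.mem_iUnion_of_mem i hx⟩).trans (hglued i x hx)⟩

end Gluing

section DisjointSupports

variable {𝕜 : Type*} [RCLike 𝕜] {E : Type*} [NormedAddCommGroup E] {K : Type*}
  [TopologicalSpace K] [CompactSpace K]

lemma norm_le_norm_sub_of_disjoint_support {f g : C(K, E)}
    (hfg : Disjoint (support f) (support g)) : ‖f‖ ≤ ‖f - g‖ := by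
  refine (ContinuousMap.norm_le _ (norm_nonneg _)).2 fun x => ?_
  by_cases hx : f x = 0
  · simp [hx]
  · have hgx : g x = 0 := Function.support_disjoint_iff.1 hfg.symm hx
    simpa [hgx] using (f - g).norm_coe_le_norm x

lemma not_isCompact_closure_range_of_disjoint_support {f : ℕ → C(K, E)} {δ : ℝ} (hδ : 0 < δ)
    (hf : ∀ n, δ ≤ ‖f n‖) (hdisj : Pairwise (Disjoint on fun n => support (f n))) :
    ¬ IsCompact (closure (Set.range f)) := by
  intro hcompact
  obtain ⟨_, -, φ, hφ, hlim⟩ := hcompact.tendsto_subseq fun n => subset_closure ⟨n, rfl⟩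
  obtain ⟨N, hN⟩ := Metric.cauchySeq_iff'.1 hlim.cauchySeq δ hδ
  have hlt : ‖f (φ (N + 1)) - f (φ N)‖ < δ := by
    simpa only [Function.comp_apply, dist_eq_norm] using hN (N + 1) N.le_succ
  have hle := norm_le_norm_sub_of_disjoint_support (hdisj (hφ.injective.ne N.succ_ne_self))
  exact (((hf _).trans hle).trans_lt hlt).false

lemma exists_norm_apply_eq_add_of_disjoint_support (χ : C(K, 𝕜) →ₗ[𝕜] 𝕜) {g h : C(K, 𝕜)}
    (hgh : Disjoint (support g) (support h)) :
    ∃ u : C(K, 𝕜), ‖u‖ ≤ max ‖g‖ ‖h‖ ∧ support u ⊆ support g ∪ support h ∧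
      ‖χ u‖ = ‖χ g‖ + ‖χ h‖ := by
  obtain ⟨a, ha, hag⟩ := RCLike.exists_norm_eq_mul_self (χ g)
  obtain ⟨b, hb, hbh⟩ := RCLike.exists_norm_eq_mul_self (χ h)
  refine ⟨a • g + b • h, ?_, fun x => ?_, ?_⟩
  · refine (ContinuousMap.norm_le _ (by positivity)).2 fun x => ?_
    by_cases hx : g x = 0
    · simpa [hx, hb] using .inr (h.norm_coe_le_norm x)
    · have hhx : h x = 0 := Function.support_disjoint_iff.1 hgh.symm hx
      simpa [hhx, ha] using .inl (g.norm_coe_le_norm x)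
  · contrapose!
    simp +contextual
  · rw [map_add, map_smul, map_smul, smul_eq_mul, smul_eq_mul, ← hag, ← hbh, ← RCLike.ofReal_add,
      RCLike.norm_of_nonneg (by positivity)]

lemma exists_seq_norm_eq_one_pairwise_disjoint_support (𝕜 : Type*) [RCLike 𝕜] (K : Type*)
    [TopologicalSpace K] [CompactSpace K] [T2Space K] [Infinite K] :
    ∃ f : ℕ → C(K, 𝕜), (∀ n, ‖f n‖ = 1) ∧ Pairwise (Disjoint on fun n => support (f n)) := by
  obtain ⟨U, hinf, hopen, hdisj⟩ := exists_seq_infinite_isOpen_pairwise_disjoint K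
  choose p hp using fun n => (hinf n).nonempty
  choose f hf0 hf1 hf using fun n => exists_continuous_zero_one_of_isClosed
    (hopen n).isClosed_compl (isClosed_singleton (x := p n)) (by simpa using hp n)
  let F : ℕ → C(K, 𝕜) := fun n => ⟨fun x => (f n x : 𝕜), by fun_prop⟩
  have hF : ∀ n x, ‖F n x‖ = f n x := fun n x => by simp [F, abs_of_nonneg (hf n x).1]
  have hsupp : ∀ n, support (F n) ⊆ U n := fun n =>
    Function.support_subset_iff'.2 fun x hx => by simp [F, hf0 n hx]
  refine ⟨F, fun n => le_antisymm ?_ ?_, fun i j hij => (hdisj hij).mono (hsupp i) (hsupp j)⟩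
  · exact (ContinuousMap.norm_le _ zero_le_one).2 fun x => (hF n x).trans_le (hf n x).2
  · have hone : ‖F n (p n)‖ = 1 := (hF n (p n)).trans (hf1 n rfl)
    exact hone.symm.trans_le ((F n).norm_coe_le_norm _)

variable [T2Space K]

lemma IsFSpace.exists_glue_of_disjoint_support (hK : IsFSpace K) {ι : Type*} [Countable ι]
    {f : ι → C(K, 𝕜)} {r : ℝ} (hr : 0 ≤ r) (hf : ∀ i, ‖f i‖ ≤ r)
    (hdisj : Pairwise (Disjoint on fun i => support (f i))) {Q : Set K}
    (hQ : IsFunctionallyOpen Q) (hfQ : ∀ i, Disjoint (support (f i)) Q) (A : Set ι) :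
    ∃ H : C(K, 𝕜), ‖H‖ ≤ r ∧ Disjoint (support H) Q ∧
      (∀ i ∈ A, Set.EqOn H (f i) (support (f i))) ∧
      ∀ i ∉ A, Disjoint (support H) (support (f i)) := by
  classical
  let U : Option ι → Set K := fun o => o.elim Q fun i => support (f i)
  let g : Option ι → C(K, 𝕜) := fun o => o.elim 0 fun i => if i ∈ A then f i else 0
  have hU : ∀ o, IsFunctionallyOpen (U o) :=
    Option.forall.2 ⟨hQ, fun i => isFunctionallyOpen_support (f i)⟩
  have hUdisj : Pairwise (Disjoint on U) := by
    rintro (_ | i) (_ | j) hij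
    exacts [(hij rfl).elim, (hfQ j).symm, hfQ i, hdisj (by simpa using hij)]
  have hg : ∀ o, ‖g o‖ ≤ r := by
    rintro (_ | i)
    · simpa [g] using hr
    · by_cases hi : i ∈ A
      · simpa [g, hi] using hf i
      · simpa [g, hi] using hr
  obtain ⟨H, hH, hHg⟩ := hK.exists_eqOn_of_pairwise_disjoint hU hUdisj hr g
    fun o x _ => ((g o).norm_coe_le_norm x).trans (hg o)
  refine ⟨H, (ContinuousMap.norm_le _ hr).2 hH, Function.support_disjoint_iff.2 (hHg none),
    fun i hi => ?_, fun i hi => Function.support_disjoint_iff.2 ?_⟩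
  · simpa [g, U, hi] using hHg (some i)
  · simpa [g, U, hi] using hHg (some i)

end DisjointSupports

section GlidingHump

variable {𝕜 : Type*} [RCLike 𝕜] {K : Type*} [TopologicalSpace K] [CompactSpace K] {δ r c : ℝ}
  {Q : Set K} {f : ℕ → C(K, 𝕜)} {χ : ℕ → WeakDual 𝕜 C(K, 𝕜)}

/-- The state of the gliding hump argument: the weak-star null functionals `χ n` stay away from
zero along disjointly supported functions `f n` in the ball of radius `r` that vanish on the cozero
set `Q`. The argument enlarges `Q` in order to decrease the bound `c` for the `χ n` on the functions
in that ball which vanish on `Q`; if `χ n` is integration against a measure `μ`, the smallest such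
`c` for it is `r * |μ| (K \ closure Q)`. -/
structure IsGlidingHump (δ r c : ℝ) (Q : Set K) (f : ℕ → C(K, 𝕜))
    (χ : ℕ → WeakDual 𝕜 C(K, 𝕜)) : Prop where
  isFunctionallyOpen : IsFunctionallyOpen Q
  pairwise_disjoint : Pairwise (Disjoint on fun n => support (f n))
  disjoint : ∀ n, Disjoint (support (f n)) Q
  norm_le : ∀ n, ‖f n‖ ≤ r
  tendsto_zero : Tendsto χ atTop (𝓝 0)
  two_mul_le_norm_apply : ∀ n, 2 * δ ≤ ‖χ n (f n)‖
  norm_apply_le : ∀ n (h : C(K, 𝕜)), ‖h‖ ≤ r → Disjoint (support h) Q → ‖χ n h‖ ≤ c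

namespace IsGlidingHump

lemma two_mul_le (hump : IsGlidingHump δ r c Q f χ) : 2 * δ ≤ c :=
  (hump.two_mul_le_norm_apply 0).trans (hump.norm_apply_le 0 _ (hump.norm_le 0) (hump.disjoint 0))

lemma eventually_le_norm_apply_sub (hump : IsGlidingHump δ r c Q f χ) (hδ : 0 < δ)
    (H : C(K, 𝕜)) : ∀ᶠ n in atTop, δ ≤ ‖χ n (H - f n)‖ := by
  filter_upwards [(tendsto_norm_weakDual_apply_zero hump.tendsto_zero H).eventually_lt_const hδ]
    with n hn
  have htri := norm_sub_norm_le (χ n (f n)) (χ n H)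
  rw [map_sub, norm_sub_rev]
  linarith [hump.two_mul_le_norm_apply n]

variable [T2Space K]

lemma exists_remainder (hump : IsGlidingHump δ r c Q f χ) (hK : IsFSpace K) (hδ : 0 < δ)
    {A : Set ℕ} (hA : A.Infinite) :
    ∃ k ∈ A, ∃ g : C(K, 𝕜), ‖g‖ ≤ r ∧ Disjoint (support g) Q ∧ δ ≤ ‖χ k g‖ ∧
      Disjoint (support g) (support (f k)) ∧ ∀ n ∉ A, Disjoint (support g) (support (f n)) := by
  have hr : 0 ≤ r := (norm_nonneg _).trans (hump.norm_le 0)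
  obtain ⟨H, hHr, hHQ, hHf, hH0⟩ := hK.exists_glue_of_disjoint_support hr hump.norm_le
    hump.pairwise_disjoint hump.isFunctionallyOpen hump.disjoint A
  obtain ⟨k, hkA, hk⟩ := ((Nat.frequently_atTop_iff_infinite.2 hA).and_eventually
    (hump.eventually_le_norm_apply_sub hδ H)).exists
  have hzero : Set.EqOn (H - f k) 0 (support (f k)) := fun x hx => by
    simp [hHf k hkA hx]
  have heq : ∀ x ∉ support (f k), (H - f k) x = H x := fun x hx => by
    simp [Function.notMem_support.1 hx]
  have hsupp : support (H - f k) ⊆ support H := fun x hx => by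
    have hxk : x ∉ support (f k) := fun h => hx (hzero h)
    rwa [Function.mem_support, heq x hxk] at hx
  refine ⟨k, hkA, H - f k, (ContinuousMap.norm_le _ hr).2 fun x => ?_, hHQ.mono_left hsupp, hk,
    Function.support_disjoint_iff.2 hzero, fun n hn => (hH0 n hn).mono_left hsupp⟩
  by_cases hx : x ∈ support (f k)
  · simpa [hzero hx] using hr
  · exact (congrArg norm (heq x hx)).trans_le ((H.norm_coe_le_norm x).trans hHr)

lemma exists_isGlidingHump_sub (hump : IsGlidingHump δ r c Q f χ) (hK : IsFSpace K) (hδ : 0 < δ) :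
    ∃ (Q' : Set K) (k : ℕ → ℕ), IsGlidingHump δ r (c - δ) Q' (f ∘ k) (χ ∘ k) := by
  let A : ℕ → Set ℕ := fun i => {n | n.unpair.1 = i}
  have hA : ∀ i, (A i).Infinite := fun i => Set.infinite_of_injective_forall_mem
    (f := Nat.pair i) (fun a b hab => (Nat.pair_eq_pair.1 hab).2) fun m => by simp [A]
  choose k hkA g hgr hgQ hgχ hgk hgA using fun i => hump.exists_remainder hK hδ (hA i)
  have hk : Function.Injective k := fun i j hij => by
    rw [← hkA i, ← hkA j, hij]
  have hgf : ∀ i j, Disjoint (support (f (k j))) (support (g i)) := fun i j => by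
    rcases eq_or_ne i j with rfl | hij
    · exact (hgk i).symm
    · exact (hgA i (k j) fun hji => hij (hji.symm.trans (hkA j))).symm
  refine ⟨Q ∪ ⋃ i, support (g i), k,
    hump.isFunctionallyOpen.union (.iUnion fun i => isFunctionallyOpen_support (g i)),
    fun i j hij => hump.pairwise_disjoint (hk.ne hij),
    fun j => Set.disjoint_union_right.2
      ⟨hump.disjoint _, Set.disjoint_iUnion_right.2 fun i => hgf i j⟩,
    fun j => hump.norm_le _, hump.tendsto_zero.comp hk.nat_tendsto_atTop,
    fun j => hump.two_mul_le_norm_apply _, fun j h hhr hh => ?_⟩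
  obtain ⟨hhQ, hhg⟩ := Set.disjoint_union_right.1 hh
  obtain ⟨u, hu, husupp, huχ⟩ := exists_norm_apply_eq_add_of_disjoint_support
    (WeakDual.toStrongDual (χ (k j))).toLinearMap (Set.disjoint_iUnion_right.1 hhg j).symm
  have hsum : ‖χ (k j) (g j)‖ + ‖χ (k j) h‖ ≤ c := huχ.symm.trans_le <|
    hump.norm_apply_le (k j) u (hu.trans (max_le (hgr j) hhr))
      ((Set.disjoint_union_left.2 ⟨hgQ j, hhQ⟩).mono_left husupp)
  exact le_sub_iff_add_le'.2 ((add_le_add_left (hgχ j) _).trans hsum)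

end IsGlidingHump

variable [T2Space K]

theorem IsFSpace.not_isGlidingHump (hK : IsFSpace K) (hδ : 0 < δ) :
    ¬ IsGlidingHump δ r c Q f χ := by
  obtain ⟨n, hn⟩ := exists_nat_ge (c / δ)
  rw [div_le_iff₀ hδ] at hn
  induction n generalizing c Q f χ with
  | zero =>
    intro hump
    rw [Nat.cast_zero, zero_mul] at hn
    linarith [hump.two_mul_le]
  | succ n ih =>
    intro hump
    obtain ⟨Q', k, hump'⟩ := hump.exists_isGlidingHump_sub hK hδ
    refine ih ?_ hump'
    push_cast at hn
    linarith

theorem IsFSpace.tendsto_apply_zero_of_disjoint_support (hK : IsFSpace K)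
    (hf : IsBounded (Set.range f)) (hdisj : Pairwise (Disjoint on fun n => support (f n)))
    (hχ : Tendsto χ atTop (𝓝 0)) : Tendsto (fun n => χ n (f n)) atTop (𝓝 0) := by
  by_contra hnot
  obtain ⟨ε, hε, hfreq⟩ : ∃ ε > 0, ∃ᶠ n in atTop, ε ≤ ‖χ n (f n)‖ := by
    simpa only [Metric.tendsto_nhds, not_forall, not_eventually, not_lt, dist_zero_right,
      exists_prop] using hnot
  obtain ⟨φ, hφ, hφε⟩ := extraction_of_frequently_atTop hfreq
  obtain ⟨r, hr⟩ := isBounded_iff_forall_norm_le.1 hf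
  obtain ⟨C, hC⟩ := exists_norm_le_of_tendsto_weakDual hχ
  have hump : IsGlidingHump (ε / 2) r (C * r) ∅ (f ∘ φ) (χ ∘ φ) := by
    refine ⟨isFunctionallyOpen_empty, hdisj.comp_of_injective hφ.injective,
      fun _ => Set.disjoint_empty _, fun n => hr _ ⟨_, rfl⟩, hχ.comp hφ.tendsto_atTop,
      fun n => ?_, fun n h hh _ => ?_⟩
    · exact (mul_div_cancel₀ ε two_ne_zero).trans_le (hφε n)
    · exact (WeakDual.toStrongDual (χ (φ n))).le_of_opNorm_le_of_le (hC _) hh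
  exact hK.not_isGlidingHump (half_pos hε) hump

theorem IsFSpace.isLimitedSet_range_of_disjoint_support (hK : IsFSpace K)
    (hf : IsBounded (Set.range f)) (hdisj : Pairwise (Disjoint on fun n => support (f n))) :
    IsLimitedSet 𝕜 (Set.range f) :=
  isLimitedSet_range_of_tendsto hf fun _ hχ φ hφ => hK.tendsto_apply_zero_of_disjoint_support
    (hf.subset (Set.range_comp_subset_range φ f)) (hdisj.comp_of_injective hφ.injective) hχ

theorem IsFSpace.not_isGelfandPhillips [Infinite K] (hK : IsFSpace K) :
    ¬ IsGelfandPhillips 𝕜 C(K, 𝕜) := fun hGP => by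
  obtain ⟨f, hf, hdisj⟩ := exists_seq_norm_eq_one_pairwise_disjoint_support 𝕜 K
  have hbounded : IsBounded (Set.range f) :=
    isBounded_iff_forall_norm_le.2 ⟨1, Set.forall_mem_range.2 fun n => (hf n).le⟩
  exact not_isCompact_closure_range_of_disjoint_support one_pos (fun n => (hf n).ge) hdisj
    (hGP _ (hK.isLimitedSet_range_of_disjoint_support hbounded hdisj))

end GlidingHump

section StoneCech

variable {Γ : Type*} [TopologicalSpace Γ] [DiscreteTopology Γ]

lemma isCStarEmbedded_stoneCech_of_isOpen {A : Set (StoneCech Γ)} (hA : IsOpen A) :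
    IsCStarEmbedded A := by
  classical
  intro f
  let φ : Γ → Metric.closedBall (0 : ℝ) ‖f‖ := fun γ =>
    if hγ : stoneCechUnit γ ∈ A then ⟨f ⟨_, hγ⟩, by simpa using f.norm_coe_le_norm _⟩
    else ⟨0, by simp⟩
  have hφ : Continuous φ := continuous_of_discreteTopology
  let F : C(StoneCech Γ, ℝ) :=
    ⟨Subtype.val ∘ stoneCechExtend hφ,
      continuous_subtype_val.comp (continuous_stoneCechExtend hφ)⟩
  have hdense : Dense (Subtype.val ⁻¹' Set.range (stoneCechUnit : Γ → StoneCech Γ) : Set A) :=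
    denseRange_stoneCechUnit.preimage hA.isOpenMap_subtype_val
  refine ⟨F, congrFun (Continuous.ext_on hdense (F.continuous.comp continuous_subtype_val)
    f.continuous ?_)⟩
  rintro ⟨_, hx⟩ ⟨γ, rfl⟩
  simp [F, φ, hx]

theorem isFSpace_stoneCech : IsFSpace (StoneCech Γ) :=
  fun _ hA => isCStarEmbedded_stoneCech_of_isOpen hA.isOpen

instance infinite_stoneCech [Infinite Γ] : Infinite (StoneCech Γ) :=
  .of_injective _ injective_stoneCechUnit_of_t35Space

/-- Restriction of continuous functions from `βX` to `X`, as a linear isometry of `C(βX)` into the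
bounded continuous functions on `X`. -/
noncomputable def stoneCechRestrict (𝕜 : Type*) [RCLike 𝕜] (X : Type*) [TopologicalSpace X] :
    C(StoneCech X, 𝕜) →ₗᵢ[𝕜] (X →ᵇ 𝕜) where
  toFun h := (BoundedContinuousFunction.mkOfCompact h).compContinuous
    ⟨stoneCechUnit, continuous_stoneCechUnit⟩
  map_add' _ _ := rfl
  map_smul' _ _ := rfl
  norm_map' h := by
    refine le_antisymm ((BoundedContinuousFunction.norm_le (norm_nonneg _)).2 fun x =>
      h.norm_coe_le_norm _) ((ContinuousMap.norm_le _ (norm_nonneg _)).2 fun x => ?_)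
    refine denseRange_stoneCechUnit.induction_on x
      (isClosed_le h.continuous.norm continuous_const) fun a => ?_
    exact ((BoundedContinuousFunction.mkOfCompact h).compContinuous
      ⟨stoneCechUnit, continuous_stoneCechUnit⟩).norm_coe_le_norm a

theorem not_isGelfandPhillips_lp_top (𝕜 : Type*) [RCLike 𝕜] (ι : Type*) [Infinite ι] :
    ¬ IsGelfandPhillips 𝕜 (lp (fun _ : ι => 𝕜) ⊤) := fun hGP => by
  let _ : TopologicalSpace ι := ⊥
  have : DiscreteTopology ι := ⟨rfl⟩
  exact isFSpace_stoneCech.not_isGelfandPhillips (hGP.of_linearIsometry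
    ((lpBCFₗᵢ 𝕜 𝕜).symm.toLinearIsometry.comp (stoneCechRestrict 𝕜 ι)))

end StoneCech

theorem mainTheorem6 (𝕜 : Type*) [RCLike 𝕜] :
    (∀ (K : Type*) [TopologicalSpace K] [CompactSpace K] [T2Space K] [Infinite K],
      IsFSpace K → ¬ IsGelfandPhillips 𝕜 C(K, 𝕜)) ∧
    (∀ (Γ : Type*) [TopologicalSpace Γ] [DiscreteTopology Γ], IsFSpace (StoneCech Γ)) ∧
    (∀ (Γ : Type*) [TopologicalSpace Γ] [DiscreteTopology Γ] [Infinite Γ],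
      ¬ IsGelfandPhillips 𝕜 C(StoneCech Γ, 𝕜)) ∧
    ¬ IsGelfandPhillips 𝕜 (lp (fun _ : ℕ => 𝕜) ⊤) :=
  ⟨fun _ _ _ _ _ hK => hK.not_isGelfandPhillips, fun _ _ _ => isFSpace_stoneCech,
    fun _ _ _ _ => isFSpace_stoneCech.not_isGelfandPhillips, not_isGelfandPhillips_lp_top 𝕜 ℕ⟩
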